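/- Let $K$ be an algebraically closed field and let $k\ge 2$ be an integer; if $K$ has characteristic $p>0$, assume that $k$ is coprime to $p$. A power series $f(z)=\sum_{i\ge 0}a_iz^i\in K[[z]]$ is called $k$-regular if the $K$-vector space spanned by the sequences $(a_{k^e i+r})_{i\ge 0}$, with $e\ge 0$ and $0\le r<k^e$, is finite-dimensional. A Mahler equation of order $n$ for $f$ is an identity $f(z)=\sum_{i=1}^{n}c_i(z)f(z^{k^i})$ in $K((z))$ with rational functions $c_1,\dots,c_n\in K(z)$ (the equation of order $0$ being $f=0$); $f$ is $k$-Mahler if it satisfies such an equation. A finite sequence of rational functions is called $k$-calm if each of its terms has, among the elements of $K$, poles only at $0$ and at roots of unity of order not coprime to $k$. Theorem. Let $f\in K[[z]]$ be $k$-Mahler, and let $f(z)=\sum_{i=1}^{n}c_i(z)f(z^{k^i})$ be a Mahler equation of minimal order satisfied by $f$. Assume that none of $c_1,\dots,c_n$ has a pole at a root of unity. Then $f$ is $k$-regular if and only if $f$ satisfies some Mahler equation $f(z)=\sum_{i=1}^{m}d_i(z)f(z^{k^i})$, of some order $m$, whose sequence of coefficients $(d_i)_{i=1}^{m}$ is $k$-calm.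 -/

import Mathlib

open scoped LaurentSeries

noncomputable section

/-- The `k`-kernel of a sequence `a`: the set of subsequences `(a_{k^e i + r})_i`
with `0 ≤ r < k^e`. -/
def kKernel {K : Type*} (k : ℕ) (a : ℕ → K) : Set (ℕ → K) :=
  {b | ∃ e r : ℕ, r < k ^ e ∧ b = fun i => a (k ^ e * i + r)}

/-- A sequence is `k`-regular if its `k`-kernel spans a finite-dimensional vector space. -/
def IsRegularSeq {K : Type*} [Field K] (k : ℕ) (a : ℕ → K) : Prop :=
  FiniteDimensional K (Submodule.span K (kKernel k a))

/-- A power series is `k`-regular if its sequence of coefficients is. -/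
def IsRegularPowerSeries {K : Type*} [Field K] (k : ℕ) (f : PowerSeries K) : Prop :=
  IsRegularSeq k (fun i => PowerSeries.coeff i f)

/-- The Mahler equation of order `n`
`f(z) = ∑_{i=1}^{n} c_i(z) f(z^{k^i})`, read in the field of formal Laurent series.
The coefficient `c_{i+1}` is `c i` for `i : Fin n`. -/
def SatisfiesMahlerEquation {K : Type*} [Field K] (k : ℕ) (f : PowerSeries K)
    {n : ℕ} (c : Fin n → RatFunc K) : Prop :=
  (f : K⸨X⸩) = ∑ i : Fin n, (c i : K⸨X⸩) *
    ((PowerSeries.subst (PowerSeries.X ^ k ^ ((i : ℕ) + 1) : PowerSeries K) f :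
      PowerSeries K) : K⸨X⸩)

/-- `c` is the sequence of coefficients of a Mahler equation of `f` of minimal order:
`f` satisfies no Mahler equation of lower order. Having such a `c` means in particular that
`f` is `k`-Mahler, and every `k`-Mahler series has one. -/
def IsMinimalMahlerEquation {K : Type*} [Field K] (k : ℕ) (f : PowerSeries K)
    {n : ℕ} (c : Fin n → RatFunc K) : Prop :=
  SatisfiesMahlerEquation k f c ∧
    ∀ (m : ℕ) (d : Fin m → RatFunc K), SatisfiesMahlerEquation k f d → n ≤ m

/-- `c` has a pole at `α`: the denominator of `c` in lowest terms vanishes at `α`. -/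
def HasPoleAt {K : Type*} [Field K] (c : RatFunc K) (α : K) : Prop :=
  c.denom.IsRoot α

/-- `α` is a root of unity: `α ^ m = 1` for some `m ≥ 1`. -/
def IsRootOfUnity {K : Type*} [Field K] (α : K) : Prop :=
  ∃ m : ℕ, 1 ≤ m ∧ α ^ m = 1

/-- `α` is `k`-calm: it is `0` or a root of unity whose order is not coprime to `k`. -/
def IsCalmNumber {K : Type*} [Field K] (k : ℕ) (α : K) : Prop :=
  α = 0 ∨ (IsRootOfUnity α ∧ ¬ (orderOf α).Coprime k)

/-- A rational function is `k`-calm if it has poles only at `k`-calm numbers. -/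
def IsCalmRatFunc {K : Type*} [Field K] (k : ℕ) (c : RatFunc K) : Prop :=
  ∀ α : K, HasPoleAt c α → IsCalmNumber k α

/-- A finite sequence of rational functions is `k`-calm if all its terms are. -/
def IsCalmSeq {K : Type*} [Field K] (k : ℕ) {n : ℕ} (c : Fin n → RatFunc K) : Prop :=
  ∀ i, IsCalmRatFunc k (c i)

end

/-!
The two implications rest on different divisibility facts about `K[z]`.

Suppose that `f` is `k`-regular and let `I` be the ideal of the `p ∈ K[z]` such that `p f` lies in
the `K[z]`-span of the series `f(z^{k^j})` with `j ≥ 1` (`PowerSeries.iterateSpan`). The product of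
the denominators of the given equation lies in `I`, and it has no root of unity as a zero. The
sections of a series that is a rational combination of the `f(z^{k^j})`, `j ≥ 0`, are again such
combinations, so the finite-dimensional span of the `k`-kernel has a common denominator `D`. The
identity `f = ∑_{r < k^J} z^r f_r(z^{k^J})`, with `f_r` in the kernel, shows that `D(z^{k^J}) ∈ I`
for all `J ≥ 1`. A common zero `α ≠ 0` of all these elements has its whole orbit `α^{k^J}` among the
finitely many zeros of `D`, hence is a root of unity, which is excluded. So the generator of `I`
vanishes at most at `0`, and dividing by it gives a Mahler equation with poles only at `0`
(`PowerSeries.exists_smul_mem_iterateSpan_of_isRegular`).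

Conversely, suppose that all poles in the equation are calm, and let `D` be the product of the
denominators. There is a polynomial `Q ≠ 0` such that `D(z) Q(z)` divides `Q(z^k)`
(`exists_mul_dvd_expand_of_isCalmNumber`). The Laurent series `g = f / Q` then satisfies a Mahler
equation with polynomial coefficients, so the span of the `z^a g(z^{k^j})` with bounded `a` and `j`
is finite-dimensional and stable under sections
(`LaurentSeries.exists_section_mem_boundedSpan`). It contains `f = Q g`, hence its kernel.
-/

/-! ### Kernels and sections -/

/-- The `k`-kernel of `a` is the orbit of `a` under the sections `b ↦ (b_{ki+s})ᵢ`, `s < k`, so any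
set that contains `a` and is stable under them contains the kernel. -/
theorem kKernel_subset {K : Type*} {k : ℕ} {a : ℕ → K} {U : Set (ℕ → K)} (ha : a ∈ U)
    (hU : ∀ b ∈ U, ∀ s < k, (fun i => b (k * i + s)) ∈ U) : kKernel k a ⊆ U := by
  rintro _ ⟨e, r, hr, rfl⟩
  induction e generalizing r with
  | zero =>
    obtain rfl : r = 0 := by simpa using hr
    simpa using ha
  | succ e ih =>
    have hpos : 0 < k ^ e := by
      rcases Nat.eq_zero_or_pos (k ^ e) with h | h
      · simp [pow_succ, h] at hr
      · exact h
    have := hU _ (ih (r % k ^ e) (Nat.mod_lt _ hpos)) (r / k ^ e)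
      (Nat.div_lt_of_lt_mul (by rwa [← pow_succ]))
    convert this using 3 with i
    conv_lhs => rw [← Nat.div_add_mod r (k ^ e)]
    ring

namespace PowerSeries

variable {K : Type*} [Field K]

/-- The Cartier section operator `∑ aᵢ zⁱ ↦ ∑ a_{ki+s} zⁱ`. -/
noncomputable def cartier (k s : ℕ) : PowerSeries K →ₗ[K] PowerSeries K where
  toFun u := PowerSeries.mk fun i => coeff (k * i + s) u
  map_add' u v := by ext; simp
  map_smul' c u := by ext; simp

@[simp]
theorem coeff_cartier (k s i : ℕ) (u : PowerSeries K) :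
    coeff i (cartier k s u) = coeff (k * i + s) u := by
  simp [cartier]

theorem cartier_X_pow_mul_expand {k : ℕ} (hk : k ≠ 0) {s : ℕ} (hs : s < k) (a : ℕ)
    (u : PowerSeries K) :
    cartier k s (X ^ a * expand k hk u) = if a % k = s then X ^ (a / k) * u else 0 := by
  have hkpos := Nat.pos_of_ne_zero hk
  ext i
  have ha := Nat.div_add_mod a k
  have hmod := Nat.mod_lt a hkpos
  rw [coeff_cartier, coeff_X_pow_mul', coeff_expand]
  split_ifs with h1 h2 h3 h3 h3
  · subst h3
    have h4 : a / k ≤ i := by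
      by_contra! h
      have : k * (i + 1) ≤ k * (a / k) := Nat.mul_le_mul_left _ h
      rw [mul_add] at this
      omega
    rw [coeff_X_pow_mul', if_pos h4]
    congr 1
    have : k * i + a % k - a = k * (i - a / k) := by
      rw [Nat.mul_sub]; omega
    rw [this, Nat.mul_div_cancel_left _ hkpos]
  · exfalso
    apply h3
    have : (a + (k * i + s - a)) % k = a % k := by
      rw [Nat.add_mod, Nat.mod_eq_zero_of_dvd h2]; simp
    rw [← this, Nat.add_sub_cancel' h1, Nat.mul_add_mod, Nat.mod_eq_of_lt hs]
  · exfalso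
    apply h2
    subst h3
    refine ⟨i - a / k, ?_⟩
    rw [Nat.mul_sub]; omega
  · simp
  · subst h3
    rw [coeff_X_pow_mul', if_neg]
    intro h4
    have : k * (a / k) ≤ k * i := Nat.mul_le_mul_left _ h4
    omega
  · simp

theorem cartier_X_pow_mul {k : ℕ} (hk : k ≠ 0) {s : ℕ} (hs : s < k) (a : ℕ)
    (u : PowerSeries K) :
    cartier k s (X ^ (k * a) * u) = X ^ a * cartier k s u := by
  have hkpos := Nat.pos_of_ne_zero hk
  ext i
  rw [coeff_cartier, coeff_X_pow_mul', coeff_X_pow_mul']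
  by_cases h : a ≤ i
  · have h' := Nat.mul_le_mul_left k h
    rw [if_pos (by omega), if_pos h, coeff_cartier]
    congr 2
    rw [Nat.mul_sub]; omega
  · have h' : k * (i + 1) ≤ k * a := Nat.mul_le_mul_left k (by omega)
    rw [mul_add] at h'
    rw [if_neg (by omega), if_neg h]

theorem polynomial_smul_def (p : Polynomial K) (u : PowerSeries K) :
    p • u = (p : PowerSeries K) * u := by
  rw [Algebra.smul_def]; rfl

theorem coe_polynomial_expand {q : ℕ} (hq : q ≠ 0) (p : Polynomial K) :
    ((Polynomial.expand K q p : Polynomial K) : PowerSeries K) = expand q hq (p : PowerSeries K) := by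
  ext i
  rw [Polynomial.coeff_coe, Polynomial.coeff_expand (Nat.pos_of_ne_zero hq), coeff_expand,
    Polynomial.coeff_coe]

theorem expand_polynomial_smul {q : ℕ} (hq : q ≠ 0) (p : Polynomial K) (u : PowerSeries K) :
    expand q hq (p • u) = Polynomial.expand K q p • expand q hq u := by
  rw [polynomial_smul_def, polynomial_smul_def, map_mul, coe_polynomial_expand]

theorem cartier_expand_smul {k : ℕ} (hk : k ≠ 0) {s : ℕ} (hs : s < k) (p : Polynomial K)
    (u : PowerSeries K) :
    cartier k s (Polynomial.expand K k p • u) = p • cartier k s u := by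
  induction p using Polynomial.induction_on' with
  | add p q hp hq => rw [map_add, add_smul, map_add, hp, hq, add_smul]
  | monomial n c =>
    rw [Polynomial.expand_monomial, ← Polynomial.C_mul_X_pow_eq_monomial,
      ← Polynomial.C_mul_X_pow_eq_monomial, polynomial_smul_def, polynomial_smul_def]
    simp only [Polynomial.coe_mul, Polynomial.coe_C, Polynomial.coe_pow, Polynomial.coe_X,
      smul_mul_assoc, ← smul_eq_C_mul, map_smul]
    rw [mul_comm n k, cartier_X_pow_mul hk hs]

theorem exists_cartier_smul_expand_eq {k : ℕ} (hk : k ≠ 0) {s : ℕ} (hs : s < k)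
    (p : Polynomial K) (u : PowerSeries K) :
    ∃ q : Polynomial K, cartier k s (p • expand k hk u) = q • u := by
  induction p using Polynomial.induction_on' with
  | add p q hp hq =>
    obtain ⟨a, ha⟩ := hp
    obtain ⟨b, hb⟩ := hq
    exact ⟨a + b, by rw [add_smul, map_add, ha, hb, add_smul]⟩
  | monomial n c =>
    refine ⟨if n % k = s then Polynomial.C c * Polynomial.X ^ (n / k) else 0, ?_⟩
    rw [← Polynomial.C_mul_X_pow_eq_monomial, polynomial_smul_def]
    simp only [Polynomial.coe_mul, Polynomial.coe_C, Polynomial.coe_pow, Polynomial.coe_X,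
      smul_mul_assoc, ← smul_eq_C_mul, map_smul]
    rw [cartier_X_pow_mul_expand hk hs]
    split_ifs
    · rw [polynomial_smul_def]
      simp [mul_assoc, smul_eq_C_mul]
    · simp

theorem eq_sum_X_pow_mul_expand {q : ℕ} (hq : q ≠ 0) (f : PowerSeries K) :
    f = ∑ r ∈ Finset.range q, X ^ r * expand q hq (cartier q r f) := by
  have hqpos := Nat.pos_of_ne_zero hq
  ext i
  rw [map_sum, Finset.sum_eq_single (i % q)]
  · rw [coeff_X_pow_mul', if_pos (Nat.mod_le _ _), coeff_expand]
    have h := Nat.div_add_mod i q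
    have h' : i - i % q = q * (i / q) := by omega
    rw [h', if_pos (dvd_mul_right _ _), Nat.mul_div_cancel_left _ hqpos, coeff_cartier, h]
  · intro r hr hne
    rw [Finset.mem_range] at hr
    rw [coeff_X_pow_mul']
    split_ifs with h
    · rw [coeff_expand_of_not_dvd]
      intro hd
      apply hne
      have : (r + (i - r)) % q = r % q := by
        rw [Nat.add_mod, Nat.mod_eq_zero_of_dvd hd]; simp
      rw [Nat.add_sub_cancel' h, Nat.mod_eq_of_lt hr] at this
      exact this.symm
    · rfl
  · intro h
    exact absurd (Finset.mem_range.2 (Nat.mod_lt _ hqpos)) h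

end PowerSeries

/-! ### Clearing denominators -/

/-- For the zeros `α` of `p`, take `q = ∏ (z - α^k)`. -/
theorem Polynomial.exists_dvd_expand {K : Type*} [Field K] [IsAlgClosed K] (k : ℕ)
    {p : Polynomial K} (hp : p ≠ 0) :
    ∃ q : Polynomial K, q ≠ 0 ∧ p ∣ Polynomial.expand K k q := by
  have hs := IsAlgClosed.splits p
  rw [hs.eq_prod_roots]
  generalize p.roots = m
  have hc : p.leadingCoeff ≠ 0 := by simpa using hp
  refine ⟨(m.map fun a => Polynomial.X - Polynomial.C (a ^ k)).prod, ?_, ?_⟩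
  · exact (Polynomial.monic_multiset_prod_of_monic _ _
      fun a _ => Polynomial.monic_X_sub_C _).ne_zero
  · rw [(Polynomial.isUnit_C.2 hc.isUnit).mul_left_dvd, map_multiset_prod, Multiset.map_map]
    refine Multiset.prod_dvd_prod_of_dvd _ _ fun a _ => ?_
    simpa using sub_dvd_pow_sub_pow (Polynomial.X : Polynomial K) (Polynomial.C a) k

theorem Submodule.exists_common_denominator {K R M : Type*} [Field K] [CommRing R] [IsDomain R]
    [Algebra K R] [AddCommGroup M] [Module R M] [Module K M] [IsScalarTower K R M]
    (N : Submodule R M) {V : Submodule K M} (hV : V.FG)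
    (h : ∀ v ∈ V, ∃ p : R, p ≠ 0 ∧ p • v ∈ N) :
    ∃ p : R, p ≠ 0 ∧ ∀ v ∈ V, p • v ∈ N := by
  classical
  obtain ⟨t, rfl⟩ := hV
  choose! p hp0 hp using h
  refine ⟨∏ v ∈ t, p v, Finset.prod_ne_zero_iff.2 fun v hv => hp0 v (subset_span hv), ?_⟩
  intro v hv
  induction hv using Submodule.span_induction with
  | mem v hv =>
    rw [← Finset.prod_erase_mul _ _ hv, mul_smul]
    exact N.smul_mem _ (hp v (subset_span hv))
  | zero => simp
  | add x y _ _ hx hy => rw [smul_add]; exact N.add_mem hx hy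
  | smul c x _ hx =>
    rw [← algebraMap_smul R c x, smul_comm]
    exact N.smul_mem _ hx

/-! ### The polynomial span of the Mahler iterates -/

namespace PowerSeries

variable {K : Type*} [Field K]

/-- The `K[z]`-submodule of `K⟦z⟧` spanned by the series `f(z^{k^j})` with `j ≥ i`. -/
noncomputable def iterateSpan {k : ℕ} (hk : k ≠ 0) (f : PowerSeries K) (i : ℕ) :
    Submodule (Polynomial K) (PowerSeries K) :=
  Submodule.span (Polynomial K) {u | ∃ j, i ≤ j ∧ u = expand (k ^ j) (pow_ne_zero j hk) f}

theorem expand_mem_iterateSpan {k : ℕ} (hk : k ≠ 0) (f : PowerSeries K) {i j : ℕ} (h : i ≤ j) :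
    expand (k ^ j) (pow_ne_zero j hk) f ∈ iterateSpan hk f i :=
  Submodule.subset_span ⟨j, h, rfl⟩

theorem iterateSpan_anti {k : ℕ} (hk : k ≠ 0) (f : PowerSeries K) {i j : ℕ} (h : i ≤ j) :
    iterateSpan hk f j ≤ iterateSpan hk f i :=
  Submodule.span_mono fun _ ⟨l, hl, e⟩ => ⟨l, h.trans hl, e⟩

theorem expand_expand_pow {k : ℕ} (hk : k ≠ 0) (i j : ℕ) (f : PowerSeries K) :
    expand (k ^ i) (pow_ne_zero i hk) (expand (k ^ j) (pow_ne_zero j hk) f) =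
      expand (k ^ (i + j)) (pow_ne_zero _ hk) f := by
  rw [← expand_mul]
  simp only [pow_add]

theorem expand_mem_iterateSpan_add {k : ℕ} (hk : k ≠ 0) {f u : PowerSeries K} {i : ℕ} (J : ℕ)
    (hu : u ∈ iterateSpan hk f i) :
    expand (k ^ J) (pow_ne_zero J hk) u ∈ iterateSpan hk f (J + i) := by
  induction hu using Submodule.span_induction with
  | mem v hv =>
    obtain ⟨j, hj, rfl⟩ := hv
    rw [expand_expand_pow hk]
    exact expand_mem_iterateSpan hk f (by omega)
  | zero => simp
  | add x y _ _ hx hy => rw [map_add]; exact Submodule.add_mem _ hx hy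
  | smul p x _ hx => rw [expand_polynomial_smul]; exact Submodule.smul_mem _ _ hx

theorem cartier_mem_iterateSpan {k : ℕ} (hk : k ≠ 0) {f u : PowerSeries K} {i s : ℕ} (hs : s < k)
    (hu : u ∈ iterateSpan hk f (i + 1)) : cartier k s u ∈ iterateSpan hk f i := by
  suffices h : ∀ p : Polynomial K, cartier k s (p • u) ∈ iterateSpan hk f i by
    simpa using h 1
  induction hu using Submodule.span_induction with
  | mem v hv =>
    obtain ⟨j, hj, rfl⟩ := hv
    obtain ⟨j, rfl⟩ : ∃ l, j = 1 + l := ⟨j - 1, by omega⟩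
    intro p
    have e := expand_expand_pow hk 1 j f
    simp only [pow_one] at e
    rw [← e]
    obtain ⟨q, hq⟩ := exists_cartier_smul_expand_eq hk hs p (expand (k ^ j) (pow_ne_zero j hk) f)
    rw [hq]
    exact Submodule.smul_mem _ _ (expand_mem_iterateSpan hk f (by omega))
  | zero => simp
  | add x y _ _ hx hy =>
    intro p
    rw [smul_add, map_add]
    exact Submodule.add_mem _ (hx p) (hy p)
  | smul c x _ hx =>
    intro p
    rw [smul_smul]
    exact hx _

/-- If `f` satisfies a Mahler equation with denominator `D`, then every element of the `k`-kernel
of `f` is a combination of the `f(z^{k^j})` with rational coefficients. -/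
theorem exists_smul_mem_iterateSpan_of_mem_kKernel [IsAlgClosed K] {k : ℕ} (hk : k ≠ 0)
    {f : PowerSeries K} {D : Polynomial K} (hD : D ≠ 0) (hf : D • f ∈ iterateSpan hk f 1)
    {b : ℕ → K} (hb : b ∈ kKernel k fun i => coeff i f) :
    ∃ p : Polynomial K, p ≠ 0 ∧ p • PowerSeries.mk b ∈ iterateSpan hk f 0 := by
  refine kKernel_subset (U := {b | ∃ p : Polynomial K, p ≠ 0 ∧
    p • PowerSeries.mk b ∈ iterateSpan hk f 0}) ?_ ?_ hb
  · refine ⟨1, one_ne_zero, ?_⟩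
    have : PowerSeries.mk (fun i => coeff i f) = f := by ext; simp
    rw [one_smul, this]
    simpa using expand_mem_iterateSpan hk f (le_refl 0)
  · rintro b ⟨p, hp, hpb⟩ s hs
    -- Multiplying by `D` removes the term `f(z)`, so that a section can be taken.
    have hDN : ∀ u ∈ iterateSpan hk f 0, D • u ∈ iterateSpan hk f 1 := by
      intro u hu
      induction hu using Submodule.span_induction with
      | mem v hv =>
        obtain ⟨j, hj, rfl⟩ := hv
        rcases Nat.eq_zero_or_pos j with rfl | hj'
        · simpa using hf
        · exact Submodule.smul_mem _ _ (expand_mem_iterateSpan hk f hj')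
      | zero => simp
      | add x y _ _ hx hy => rw [smul_add]; exact Submodule.add_mem _ hx hy
      | smul c x _ hx => rw [smul_comm]; exact Submodule.smul_mem _ _ hx
    obtain ⟨q, hq, r, hr⟩ := Polynomial.exists_dvd_expand k (mul_ne_zero hD hp)
    refine ⟨q, hq, ?_⟩
    have e : PowerSeries.mk (fun i => b (k * i + s)) = cartier k s (PowerSeries.mk b) := by
      ext; simp
    rw [e, ← cartier_expand_smul hk hs, hr]
    apply cartier_mem_iterateSpan hk hs
    rw [mul_comm, mul_smul, mul_smul]
    exact Submodule.smul_mem _ _ (hDN _ hpb)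

/-- If `D` is a common denominator of the `k`-kernel of `f`, then `D(z^{k^J})` clears the
denominators in an expression of `f` through the `f(z^{k^j})` with `j ≥ J`. -/
theorem expand_smul_mem_iterateSpan {k : ℕ} (hk : k ≠ 0) {f : PowerSeries K} {D : Polynomial K}
    (h : ∀ b ∈ kKernel k fun i => coeff i f, D • PowerSeries.mk b ∈ iterateSpan hk f 0) (J : ℕ) :
    Polynomial.expand K (k ^ J) D • f ∈ iterateSpan hk f J := by
  have hJ := pow_ne_zero J hk
  have hsum : Polynomial.expand K (k ^ J) D • f = ∑ r ∈ Finset.range (k ^ J),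
      (Polynomial.X ^ r : Polynomial K) •
        expand (k ^ J) hJ (D • cartier (k ^ J) r f) := by
    conv_lhs => rw [eq_sum_X_pow_mul_expand hJ f, Finset.smul_sum]
    refine Finset.sum_congr rfl fun r _ => ?_
    rw [expand_polynomial_smul]
    simp only [polynomial_smul_def, Polynomial.coe_pow, Polynomial.coe_X]
    rw [mul_left_comm]
  rw [hsum]
  refine Submodule.sum_mem _ fun r hr => Submodule.smul_mem _ _ ?_
  have hmem := h (fun i => coeff (k ^ J * i + r) f) ⟨J, r, Finset.mem_range.1 hr, rfl⟩
  have e : PowerSeries.mk (fun i => coeff (k ^ J * i + r) f) = cartier (k ^ J) r f := by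
    ext; simp
  rw [e] at hmem
  have hJm := expand_mem_iterateSpan_add hk J hmem
  rw [Nat.add_zero] at hJm
  exact hJm

/-- The ideal of the `p` with `p f ∈ ∑_{j ≥ 1} K[z] f(z^{k^j})` has no zero besides `0`, if one
of its elements has no roots of unity as zeros. -/
theorem exists_smul_mem_iterateSpan_of_isRegular [IsAlgClosed K] {k : ℕ} (hk : 2 ≤ k)
    {f : PowerSeries K} (hreg : IsRegularPowerSeries k f) {D : Polynomial K}
    (hf : D • f ∈ iterateSpan (by omega : k ≠ 0) f 1)
    (hroot : ∀ ζ : K, IsRootOfUnity ζ → ¬ D.IsRoot ζ) :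
    ∃ g : Polynomial K, g ≠ 0 ∧ (∀ α, g.IsRoot α → α = 0) ∧
      g • f ∈ iterateSpan (by omega : k ≠ 0) f 1 := by
  classical
  have hk0 : k ≠ 0 := by omega
  have hD : D ≠ 0 := by
    rintro rfl
    exact hroot 1 ⟨1, le_rfl, one_pow 1⟩ (by simp)
  let L : (ℕ → K) →ₗ[K] PowerSeries K :=
    { toFun := PowerSeries.mk, map_add' := fun u v => by ext; simp,
      map_smul' := fun c u => by ext; simp }
  have hfin : FiniteDimensional K (Submodule.span K (kKernel k fun i => coeff i f)) := hreg
  have hfg : (Submodule.span K (kKernel k fun i => coeff i f)).FG :=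
    Module.Finite.iff_fg.1 hfin
  obtain ⟨E, hE, hEN⟩ := Submodule.exists_common_denominator (iterateSpan hk0 f 0) (hfg.map L) (by
    rintro _ ⟨b, hb, rfl⟩
    induction hb using Submodule.span_induction with
    | mem b hb => exact exists_smul_mem_iterateSpan_of_mem_kKernel hk0 hD hf hb
    | zero => exact ⟨1, one_ne_zero, by simp⟩
    | add x y _ _ hx hy =>
      obtain ⟨p, hp, hp'⟩ := hx
      obtain ⟨q, hq, hq'⟩ := hy
      refine ⟨p * q, mul_ne_zero hp hq, ?_⟩
      rw [map_add, smul_add]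
      refine Submodule.add_mem _ ?_ ?_
      · rw [mul_comm, mul_smul]; exact Submodule.smul_mem _ _ hp'
      · rw [mul_smul]; exact Submodule.smul_mem _ _ hq'
    | smul c x _ hx =>
      obtain ⟨p, hp, hp'⟩ := hx
      refine ⟨p, hp, ?_⟩
      rw [map_smul, smul_comm, ← algebraMap_smul (Polynomial K) c]
      exact Submodule.smul_mem _ _ hp')
  have hEJ := expand_smul_mem_iterateSpan hk0 (D := E)
    (fun b hb => hEN _ ⟨b, Submodule.subset_span hb, rfl⟩)
  let I : Ideal (Polynomial K) :=
    (iterateSpan hk0 f 1).comap (LinearMap.toSpanSingleton (Polynomial K) (PowerSeries K) f)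
  have hI : ∀ p, p • f ∈ iterateSpan hk0 f 1 → Submodule.IsPrincipal.generator I ∣ p := by
    intro p hp
    rw [← Submodule.IsPrincipal.mem_iff_generator_dvd]
    exact hp
  refine ⟨Submodule.IsPrincipal.generator I, ?_, ?_,
    Submodule.IsPrincipal.generator_mem I⟩
  · intro h0
    have := hI D hf
    rw [h0, zero_dvd_iff] at this
    exact hD this
  · intro α hα
    by_contra h0
    have h1 : ∀ J, α ^ k ^ (J + 1) ∈ E.roots.toFinset := by
      intro J
      have := hα.dvd (hI _ (iterateSpan_anti hk0 f (by omega) (hEJ (J + 1))))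
      rw [Multiset.mem_toFinset, Polynomial.mem_roots hE]
      simpa [Polynomial.IsRoot, Polynomial.expand_eval] using this
    -- Finitely many roots of `E`: two members of the orbit of `α` coincide.
    obtain ⟨a, b, hab, he⟩ : ∃ a b : ℕ, a < b ∧ α ^ k ^ (a + 1) = α ^ k ^ (b + 1) := by
      have hni : ¬ Function.Injective
          fun J : ℕ => (⟨α ^ k ^ (J + 1), h1 J⟩ : E.roots.toFinset) :=
        not_injective_infinite_finite _
      rw [Function.not_injective_iff] at hni
      obtain ⟨a, b, e, hne⟩ := hni
      have e := congrArg Subtype.val e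
      rcases lt_or_gt_of_ne hne with h | h
      · exact ⟨a, b, h, e⟩
      · exact ⟨b, a, h, e.symm⟩
    have hlt : k ^ (a + 1) < k ^ (b + 1) := Nat.pow_lt_pow_right (by omega) (by omega)
    refine hroot α ⟨k ^ (b + 1) - k ^ (a + 1), by omega, ?_⟩ (hα.dvd (hI D hf))
    have hne : α ^ k ^ (a + 1) ≠ 0 := pow_ne_zero _ h0
    apply mul_left_cancel₀ hne
    rw [← pow_add, mul_one, Nat.add_sub_cancel' hlt.le, he]

theorem mem_iterateSpan_one_iff {k : ℕ} (hk : k ≠ 0) {f u : PowerSeries K} :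
    u ∈ iterateSpan hk f 1 ↔ ∃ (m : ℕ) (p : Fin m → Polynomial K),
      u = ∑ i : Fin m, p i • expand (k ^ ((i : ℕ) + 1)) (pow_ne_zero _ hk) f := by
  constructor
  · intro hu
    suffices h : ∃ (m : ℕ) (p : ℕ → Polynomial K), u = ∑ i ∈ Finset.range m,
        p i • expand (k ^ (i + 1)) (pow_ne_zero _ hk) f by
      obtain ⟨m, p, h⟩ := h
      exact ⟨m, fun i => p i, by rw [h, Finset.sum_range]⟩
    have key : {u | ∃ j, 1 ≤ j ∧ u = expand (k ^ j) (pow_ne_zero j hk) f} =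
        Set.range fun i : ℕ => expand (k ^ (i + 1)) (pow_ne_zero _ hk) f := by
      ext v
      constructor
      · rintro ⟨j, hj, rfl⟩
        obtain ⟨j, rfl⟩ : ∃ l, j = l + 1 := ⟨j - 1, by omega⟩
        exact ⟨j, rfl⟩
      · rintro ⟨j, rfl⟩
        exact ⟨j + 1, by omega, rfl⟩
    rw [iterateSpan, key, Finsupp.mem_span_range_iff_exists_finsupp] at hu
    obtain ⟨c, rfl⟩ := hu
    refine ⟨c.support.sup id + 1, c, ?_⟩
    rw [Finsupp.sum]
    refine Finset.sum_subset (fun i hi => ?_) fun i _ hi => ?_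
    · have := Finset.le_sup (f := id) hi
      simp only [id] at this
      exact Finset.mem_range.2 (by omega)
    · rw [Finsupp.notMem_support_iff.1 hi, zero_smul]
  · rintro ⟨m, p, rfl⟩
    exact Submodule.sum_mem _ fun i _ =>
      Submodule.smul_mem _ _ (expand_mem_iterateSpan hk f (by omega))

end PowerSeries

/-! ### The substitution `z ↦ z^q` on Laurent series -/

namespace LaurentSeries

variable {K : Type*} [Field K]

/-- The ring homomorphism `u(z) ↦ u(z^q)` on formal Laurent series, for `q ≠ 0`. -/
noncomputable def expand (q : ℕ) (hq : q ≠ 0) : K⸨X⸩ →+* K⸨X⸩ :=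
  HahnSeries.embDomainRingHom (AddMonoidHom.mulLeft (q : ℤ))
    (fun a b h => mul_left_cancel₀ (Nat.cast_ne_zero.2 hq) h)
    (fun a b => mul_le_mul_iff_right₀ (by exact_mod_cast Nat.pos_of_ne_zero hq))

theorem coeff_expand_mul (q : ℕ) (hq : q ≠ 0) (u : K⸨X⸩) (i : ℤ) :
    (expand q hq u).coeff (q * i) = u.coeff i :=
  HahnSeries.embDomain_coeff

theorem coeff_expand_of_not_dvd (q : ℕ) (hq : q ≠ 0) (u : K⸨X⸩) (i : ℤ) (h : ¬ (q : ℤ) ∣ i) :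
    (expand q hq u).coeff i = 0 :=
  HahnSeries.embDomain_of_notMem_range (by rintro ⟨j, rfl⟩; exact h ⟨j, rfl⟩)

theorem expand_coe {q : ℕ} (hq : q ≠ 0) (f : PowerSeries K) :
    expand q hq (f : K⸨X⸩) = (PowerSeries.expand q hq f : PowerSeries K) := by
  ext i
  by_cases hd : (q : ℤ) ∣ i
  · obtain ⟨j, rfl⟩ := hd
    rw [coeff_expand_mul]
    rcases lt_or_ge j 0 with hj | hj
    · have hqj : (q : ℤ) * j < 0 :=
        mul_neg_of_pos_of_neg (by exact_mod_cast Nat.pos_of_ne_zero hq) hj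
      rw [PowerSeries.coeff_coe, PowerSeries.coeff_coe, if_pos hj, if_pos hqj]
    · lift j to ℕ using hj
      rw [← Nat.cast_mul, coeff_coe_powerSeries, coeff_coe_powerSeries,
        PowerSeries.coeff_expand_mul]
  · rw [coeff_expand_of_not_dvd _ _ _ _ hd]
    rcases lt_or_ge i 0 with hi | hi
    · rw [PowerSeries.coeff_coe, if_pos hi]
    · lift i to ℕ using hi
      rw [coeff_coe_powerSeries, PowerSeries.coeff_expand_of_not_dvd]
      exact_mod_cast hd

theorem expand_expand {p q : ℕ} (hp : p ≠ 0) (hq : q ≠ 0) (u : K⸨X⸩) :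
    expand p hp (expand q hq u) = expand (p * q) (mul_ne_zero hp hq) u := by
  ext i
  by_cases hd : (p : ℤ) ∣ i
  · obtain ⟨j, rfl⟩ := hd
    rw [coeff_expand_mul]
    by_cases hd : (q : ℤ) ∣ j
    · obtain ⟨l, rfl⟩ := hd
      rw [coeff_expand_mul, ← mul_assoc, ← Nat.cast_mul, coeff_expand_mul]
    · rw [coeff_expand_of_not_dvd _ _ _ _ hd, coeff_expand_of_not_dvd]
      rwa [Nat.cast_mul, mul_dvd_mul_iff_left (Nat.cast_ne_zero.2 hp)]
  · rw [coeff_expand_of_not_dvd _ _ _ _ hd, coeff_expand_of_not_dvd]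
    rw [Nat.cast_mul]
    exact fun h => hd (dvd_of_mul_right_dvd h)

theorem expand_one (u : K⸨X⸩) (h : 1 ≠ 0) : expand 1 h u = u := by
  ext i
  simpa using coeff_expand_mul 1 h u i

theorem polynomial_smul_def (p : Polynomial K) (u : K⸨X⸩) :
    p • u = ((p : PowerSeries K) : K⸨X⸩) * u := by
  rw [Algebra.smul_def]
  rfl

theorem polynomial_C_smul (c : K) (u : K⸨X⸩) : Polynomial.C c • u = c • u := by
  rw [polynomial_smul_def, Polynomial.coe_C, PowerSeries.coe_C, HahnSeries.C_mul_eq_smul]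

theorem coe_polynomial_smul (p : Polynomial K) (u : PowerSeries K) :
    ((p • u : PowerSeries K) : K⸨X⸩) = p • (u : K⸨X⸩) := by
  rw [polynomial_smul_def, PowerSeries.polynomial_smul_def, PowerSeries.coe_mul]

theorem coeff_X_pow_smul (a : ℕ) (u : K⸨X⸩) (i : ℤ) :
    ((Polynomial.X ^ a : Polynomial K) • u).coeff i = u.coeff (i - a) := by
  rw [polynomial_smul_def]
  have : (((Polynomial.X ^ a : Polynomial K) : PowerSeries K) : K⸨X⸩) =
      HahnSeries.single (a : ℤ) 1 := by
    simp [HahnSeries.ofPowerSeries_X_pow]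
  rw [this]
  have h := HahnSeries.coeff_single_mul_add (r := (1 : K)) (x := u) (a := i - a) (b := (a : ℤ))
  rw [sub_add_cancel, one_mul] at h
  exact h

/-- The value of the section operator `∑ aᵢ zⁱ ↦ ∑ a_{ki+s} zⁱ` on `z^a u(z^k)`. -/
theorem coeff_X_pow_smul_expand {k : ℕ} (hk : k ≠ 0) {s : ℕ} (hs : s < k) (a : ℕ) (u : K⸨X⸩)
    (i : ℤ) :
    ((Polynomial.X ^ a : Polynomial K) • expand k hk u).coeff (k * i + s) =
      if a % k = s then ((Polynomial.X ^ (a / k) : Polynomial K) • u).coeff i else 0 := by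
  have hkpos := Nat.pos_of_ne_zero hk
  have ha : (k : ℤ) * (a / k : ℕ) + (a % k : ℕ) = a := by exact_mod_cast Nat.div_add_mod a k
  rw [coeff_X_pow_smul]
  split_ifs with h
  · rw [coeff_X_pow_smul, ← coeff_expand_mul k hk u]
    congr 1
    rw [← h, mul_sub]
    linarith
  · apply coeff_expand_of_not_dvd
    rintro ⟨j, hj⟩
    apply h
    have e : (s : ℤ) - (a % k : ℕ) = k * (j - i + (a / k : ℕ)) := by
      linear_combination hj - ha
    have hm := Nat.mod_lt a hkpos
    have hd : (k : ℤ) ∣ (s : ℤ) - (a % k : ℕ) := ⟨_, e⟩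
    have := Int.eq_zero_of_abs_lt_dvd hd (by rw [abs_lt]; omega)
    omega

/-! ### Mahler equations with polynomial coefficients -/

/-- The `K`-span of the `z^a g(z^{k^j})` with `a ≤ B` and `j ≤ m`. -/
noncomputable def boundedSpan {k : ℕ} (hk : k ≠ 0) (g : K⸨X⸩) (B m : ℕ) : Submodule K K⸨X⸩ :=
  Submodule.span K (Set.range fun x : Fin (B + 1) × Fin (m + 1) =>
    (Polynomial.X ^ (x.1 : ℕ) : Polynomial K) • expand (k ^ (x.2 : ℕ)) (pow_ne_zero _ hk) g)

theorem X_pow_smul_mem_boundedSpan {k : ℕ} (hk : k ≠ 0) (g : K⸨X⸩) {B m a j : ℕ} (ha : a ≤ B)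
    (hj : j ≤ m) :
    (Polynomial.X ^ a : Polynomial K) • expand (k ^ j) (pow_ne_zero _ hk) g ∈
      boundedSpan hk g B m :=
  Submodule.subset_span ⟨(⟨a, by omega⟩, ⟨j, by omega⟩), rfl⟩

theorem polynomial_smul_eq_sum (p : Polynomial K) (u : K⸨X⸩) :
    p • u = ∑ a ∈ Finset.range (p.natDegree + 1),
      p.coeff a • ((Polynomial.X ^ a : Polynomial K) • u) := by
  conv_lhs => rw [p.as_sum_range_C_mul_X_pow, Finset.sum_smul]
  refine Finset.sum_congr rfl fun a _ => ?_
  rw [mul_smul, polynomial_C_smul]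

theorem polynomial_smul_mem_boundedSpan {k : ℕ} (hk : k ≠ 0) (g : K⸨X⸩) {B m j : ℕ}
    {p : Polynomial K} (hp : p.natDegree ≤ B) (hj : j ≤ m) :
    p • expand (k ^ j) (pow_ne_zero _ hk) g ∈ boundedSpan hk g B m := by
  rw [polynomial_smul_eq_sum]
  refine Submodule.sum_mem _ fun a ha => Submodule.smul_mem _ _
    (X_pow_smul_mem_boundedSpan hk g ?_ hj)
  have := Finset.mem_range.1 ha
  omega

/-- If `g` satisfies a Mahler equation of order `m` with polynomial coefficients of degree at most
`B`, then the section operators map the span of the `z^a g(z^{k^j})`, `a ≤ B`, `j ≤ m`, to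
itself. -/
theorem exists_section_mem_boundedSpan {k : ℕ} (hk : 2 ≤ k) {g : K⸨X⸩} {m B : ℕ}
    {p : Fin m → Polynomial K} (hB : ∀ i, (p i).natDegree ≤ B)
    (hg : g = ∑ i : Fin m, p i • expand (k ^ ((i : ℕ) + 1)) (pow_ne_zero _ (by omega)) g)
    {w : K⸨X⸩} (hw : w ∈ boundedSpan (by omega : k ≠ 0) g B m) {s : ℕ} (hs : s < k) :
    ∃ w' ∈ boundedSpan (by omega : k ≠ 0) g B m, ∀ i : ℤ, w'.coeff i = w.coeff (k * i + s) := by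
  have hk0 : k ≠ 0 := by omega
  have hadd : ∀ {x y : K⸨X⸩},
      (∃ w' ∈ boundedSpan hk0 g B m, ∀ i : ℤ, w'.coeff i = x.coeff (k * i + s)) →
      (∃ w' ∈ boundedSpan hk0 g B m, ∀ i : ℤ, w'.coeff i = y.coeff (k * i + s)) →
      ∃ w' ∈ boundedSpan hk0 g B m, ∀ i : ℤ, w'.coeff i = (x + y).coeff (k * i + s) := by
    rintro x y ⟨x', hx, hx'⟩ ⟨y', hy, hy'⟩
    exact ⟨x' + y', Submodule.add_mem _ hx hy, fun i => by
      rw [HahnSeries.coeff_add, HahnSeries.coeff_add, hx', hy']⟩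
  have hsmul : ∀ (c : K) {x : K⸨X⸩},
      (∃ w' ∈ boundedSpan hk0 g B m, ∀ i : ℤ, w'.coeff i = x.coeff (k * i + s)) →
      ∃ w' ∈ boundedSpan hk0 g B m, ∀ i : ℤ, w'.coeff i = (c • x).coeff (k * i + s) := by
    rintro c x ⟨x', hx, hx'⟩
    exact ⟨c • x', Submodule.smul_mem _ _ hx, fun i => by
      rw [HahnSeries.coeff_smul, HahnSeries.coeff_smul, hx']⟩
  have hzero : ∃ w' ∈ boundedSpan hk0 g B m, ∀ i : ℤ,
      w'.coeff i = (0 : K⸨X⸩).coeff (k * i + s) := ⟨0, Submodule.zero_mem _, fun i => rfl⟩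
  have hsum : ∀ {ι : Type} (t : Finset ι) (x : ι → K⸨X⸩),
      (∀ j ∈ t, ∃ w' ∈ boundedSpan hk0 g B m, ∀ i : ℤ, w'.coeff i = (x j).coeff (k * i + s)) →
      ∃ w' ∈ boundedSpan hk0 g B m, ∀ i : ℤ,
        w'.coeff i = (∑ j ∈ t, x j).coeff (k * i + s) := by
    intro ι t x h
    exact Finset.sum_induction x (fun x => ∃ w' ∈ boundedSpan hk0 g B m, ∀ i : ℤ,
      w'.coeff i = x.coeff (k * i + s)) (fun _ _ => hadd) hzero h
  -- A section of `z^a g(z^{k^{j+1}})` is `0` or `z^{⌊a/k⌋} g(z^{k^j})`, and `⌊2B/k⌋ ≤ B`.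
  have hmon : ∀ a j : ℕ, a ≤ 2 * B → j < m → ∃ w' ∈ boundedSpan hk0 g B m, ∀ i : ℤ,
      w'.coeff i = ((Polynomial.X ^ a : Polynomial K) •
        expand (k ^ (j + 1)) (pow_ne_zero _ hk0) g).coeff (k * i + s) := by
    intro a j ha hj
    have e : expand (k ^ (j + 1)) (pow_ne_zero _ hk0) g =
        expand k hk0 (expand (k ^ j) (pow_ne_zero _ hk0) g) := by
      rw [expand_expand]
      simp only [pow_succ']
    rw [e]
    by_cases has : a % k = s
    · refine ⟨_, X_pow_smul_mem_boundedSpan hk0 g (a := a / k) (j := j) ?_ hj.le, fun i => ?_⟩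
      · calc a / k ≤ a / 2 := Nat.div_le_div_left hk (by norm_num)
          _ ≤ B := by omega
      · rw [coeff_X_pow_smul_expand hk0 hs, if_pos has]
    · refine ⟨0, Submodule.zero_mem _, fun i => ?_⟩
      rw [coeff_X_pow_smul_expand hk0 hs, if_neg has]
      rfl
  induction hw using Submodule.span_induction with
  | mem w hw =>
    obtain ⟨⟨a, j⟩, rfl⟩ := hw
    obtain ⟨a, ha⟩ := a
    obtain ⟨j, hj⟩ := j
    simp only
    rcases j with _ | j
    · have e : expand (k ^ 0) (pow_ne_zero _ hk0) g = g := by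
        simp only [pow_zero]
        exact expand_one g _
      rw [e, congrArg ((Polynomial.X ^ a : Polynomial K) • ·) hg]
      simp only [Finset.smul_sum]
      refine hsum _ _ fun i _ => ?_
      rw [polynomial_smul_eq_sum (p i), Finset.smul_sum]
      refine hsum _ _ fun b hb => ?_
      rw [← polynomial_C_smul, smul_comm, polynomial_C_smul, smul_smul, ← pow_add]
      have := hB i
      have := Finset.mem_range.1 hb
      exact hsmul _ (hmon _ _ (by omega) i.2)
    · exact hmon a j (by omega) (by omega)
  | zero => exact hzero
  | add x y _ _ hx hy => exact hadd hx hy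
  | smul c x _ hx => exact hsmul c hx

/-- If the Laurent series `g` satisfies a Mahler equation with polynomial coefficients and
`f = Q g` is a power series, for some polynomial `Q`, then `f` is `k`-regular. -/
theorem isRegularPowerSeries_of_polynomial_equation {k : ℕ} (hk : 2 ≤ k) {g : K⸨X⸩} {m : ℕ}
    {p : Fin m → Polynomial K}
    (hg : g = ∑ i : Fin m, p i • expand (k ^ ((i : ℕ) + 1)) (pow_ne_zero _ (by omega)) g)
    {f : PowerSeries K} {Q : Polynomial K} (hf : (f : K⸨X⸩) = Q • g) :
    IsRegularPowerSeries k f := by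
  have hk0 : k ≠ 0 := by omega
  set B := Q.natDegree + ∑ i, (p i).natDegree with hBdef
  have hB : ∀ i, (p i).natDegree ≤ B := fun i =>
    (Finset.single_le_sum (f := fun i => (p i).natDegree) (fun _ _ => Nat.zero_le _)
      (Finset.mem_univ i)).trans (Nat.le_add_left _ _)
  let coeffs : K⸨X⸩ →ₗ[K] (ℕ → K) :=
    { toFun := fun w i => w.coeff i
      map_add' := fun u v => by ext; simp
      map_smul' := fun c u => by ext; simp }
  have hfin : FiniteDimensional K (boundedSpan hk0 g B m) :=
    FiniteDimensional.span_of_finite K (Set.finite_range _)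
  have hle : Submodule.span K (kKernel k fun i => PowerSeries.coeff i f) ≤
      (boundedSpan hk0 g B m).map coeffs := by
    rw [Submodule.span_le]
    apply kKernel_subset
    · refine ⟨f, ?_, ?_⟩
      · have := polynomial_smul_mem_boundedSpan hk0 g (B := B) (m := m) (j := 0) (p := Q)
          (Nat.le_add_right _ _) (Nat.zero_le _)
        simp only [pow_zero, expand_one] at this
        rw [hf]
        exact this
      · ext i
        exact coeff_coe_powerSeries f i
    · rintro _ ⟨w, hw, rfl⟩ s hs
      obtain ⟨w', hw', h⟩ := exists_section_mem_boundedSpan hk hB hg hw hs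
      refine ⟨w', hw', ?_⟩
      ext i
      change w'.coeff i = w.coeff ((k * i + s : ℕ) : ℤ)
      rw [h]
      push_cast
      rfl
  exact Submodule.finiteDimensional_of_le hle

end LaurentSeries

/-! ### Removing calm poles -/

/-- For `D = z` take `Q = z`; for `D = z - ζ` take for `Q` the product of the `z - ω` over the
forward orbit `ω = ζ^{k^j}`, `j ≥ 1`. The orbit is mapped to itself by `ω ↦ ω^k`, and `ζ` is not in
it because its order is not coprime to `k`. -/
theorem IsCalmNumber.exists_mul_dvd_expand {K : Type*} [Field K] {k : ℕ} (hk : 2 ≤ k) {ζ : K}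
    (hζ : IsCalmNumber k ζ) :
    ∃ Q : Polynomial K, Q ≠ 0 ∧
      (Polynomial.X - Polynomial.C ζ) * Q ∣ Polynomial.expand K k Q := by
  classical
  rcases hζ with rfl | ⟨⟨m, hm, hζ⟩, hcop⟩
  · refine ⟨Polynomial.X, Polynomial.X_ne_zero, ?_⟩
    rw [Polynomial.expand_X, map_zero, sub_zero, ← sq]
    exact pow_dvd_pow _ hk
  · set O : Finset K := (Polynomial.nthRootsFinset m (1 : K)).filter
      fun ω => ∃ j, 1 ≤ j ∧ ω = ζ ^ k ^ j with hO
    have hmem : ∀ j, 1 ≤ j → ζ ^ k ^ j ∈ O := by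
      intro j hj
      rw [hO, Finset.mem_filter, Polynomial.mem_nthRootsFinset hm]
      refine ⟨?_, j, hj, rfl⟩
      rw [← pow_mul, mul_comm, pow_mul, hζ, one_pow]
    have hnot : ζ ∉ O := by
      intro h
      obtain ⟨j, hj, h⟩ := (Finset.mem_filter.1 h).2
      apply hcop
      have h0 : ζ ≠ 0 := by
        rintro rfl
        rw [zero_pow (by omega)] at hζ
        exact zero_ne_one hζ
      have hpos : 1 ≤ k ^ j := Nat.one_le_pow _ _ (by omega)
      have h1 : ζ ^ (k ^ j - 1) = 1 := by
        apply mul_left_cancel₀ h0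
        rw [← pow_succ', Nat.sub_add_cancel hpos, mul_one, ← h]
      have h2 := orderOf_dvd_of_pow_eq_one h1
      have h3 : (k ^ j - 1).Coprime (k ^ j) := by
        rw [Nat.coprime_comm]
        exact (Nat.coprime_self_sub_right hpos).2 (Nat.coprime_one_right _)
      exact (Nat.Coprime.coprime_dvd_left h2 h3).coprime_dvd_right (dvd_pow_self k (by omega))
    refine ⟨∏ ω ∈ O, (Polynomial.X - Polynomial.C ω),
      (Polynomial.monic_prod_of_monic _ _ fun ω _ => Polynomial.monic_X_sub_C ω).ne_zero, ?_⟩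
    rw [← Finset.prod_insert (f := fun ω => Polynomial.X - Polynomial.C ω) hnot]
    apply Finset.prod_dvd_of_coprime
    · intro a _ b _ hab
      exact Polynomial.isCoprime_X_sub_C_of_isUnit_sub (sub_ne_zero.2 hab).isUnit
    · intro ω hω
      rw [Polynomial.dvd_iff_isRoot, Polynomial.IsRoot, Polynomial.expand_eval,
        Polynomial.eval_prod]
      apply Finset.prod_eq_zero (i := ω ^ k) _ (by simp)
      rcases Finset.mem_insert.1 hω with rfl | hω
      · simpa using hmem 1 le_rfl
      · obtain ⟨j, hj, rfl⟩ := (Finset.mem_filter.1 hω).2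
        rw [← pow_mul, ← pow_succ]
        exact hmem _ (by omega)

/-- A polynomial `D` all of whose zeros are calm divides a quotient `Q(z^k) / Q(z)`. -/
theorem exists_mul_dvd_expand_of_isCalmNumber {K : Type*} [Field K] [IsAlgClosed K] {k : ℕ}
    (hk : 2 ≤ k) {D : Polynomial K} (hD : D ≠ 0) (h : ∀ α, D.IsRoot α → IsCalmNumber k α) :
    ∃ Q : Polynomial K, Q ≠ 0 ∧ D * Q ∣ Polynomial.expand K k Q := by
  have hroots : ∀ α ∈ D.roots, IsCalmNumber k α := fun α hα =>
    h α (Polynomial.isRoot_of_mem_roots hα)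
  have hs := IsAlgClosed.splits D
  rw [hs.eq_prod_roots]
  have hc : IsUnit (Polynomial.C D.leadingCoeff) :=
    Polynomial.isUnit_C.2 (isUnit_iff_ne_zero.2 (by simpa using hD))
  simp only [mul_assoc, hc.mul_left_dvd]
  generalize D.roots = s at hroots
  induction s using Multiset.induction_on with
  | empty => exact ⟨1, one_ne_zero, by simp⟩
  | cons a s ih =>
    obtain ⟨Q, hQ, hd⟩ := ih fun α hα => hroots α (Multiset.mem_cons_of_mem hα)
    obtain ⟨P, hP, hd'⟩ := (hroots a (Multiset.mem_cons_self a s)).exists_mul_dvd_expand hk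
    refine ⟨P * Q, mul_ne_zero hP hQ, ?_⟩
    rw [Multiset.map_cons, Multiset.prod_cons, map_mul, mul_mul_mul_comm]
    exact mul_dvd_mul hd' hd

theorem Polynomial.mul_dvd_expand_pow {K : Type*} [Field K] {k : ℕ} {D Q : Polynomial K}
    (h : D * Q ∣ expand K k Q) (i : ℕ) : D * Q ∣ expand K (k ^ (i + 1)) Q := by
  induction i with
  | zero => simpa using h
  | succ i ih =>
    obtain ⟨R, hR⟩ := (dvd_of_mul_left_dvd ih)
    rw [pow_succ', expand_mul, hR, map_mul]
    exact h.mul_right _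

/-! ### Mahler equations with rational coefficients -/

theorem satisfiesMahlerEquation_iff {K : Type*} [Field K] {k : ℕ} (hk : k ≠ 0)
    {f : PowerSeries K} {n : ℕ} {c : Fin n → RatFunc K} :
    SatisfiesMahlerEquation k f c ↔ (f : K⸨X⸩) = ∑ i : Fin n, (c i : K⸨X⸩) *
      LaurentSeries.expand (k ^ ((i : ℕ) + 1)) (pow_ne_zero _ hk) (f : K⸨X⸩) := by
  simp only [SatisfiesMahlerEquation, LaurentSeries.expand_coe, PowerSeries.expand_apply]

theorem RatFunc.coe_polynomial_mul {K : Type*} [Field K] (p : Polynomial K) (u : K⸨X⸩) :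
    ((algebraMap (Polynomial K) (RatFunc K) p : RatFunc K) : K⸨X⸩) * u = p • u := by
  rw [← IsScalarTower.algebraMap_apply, ← Algebra.smul_def]

theorem RatFunc.exists_prod_denom_mul_eq {K : Type*} [Field K] {n : ℕ} (c : Fin n → RatFunc K)
    (i : Fin n) :
    ∃ p : Polynomial K, algebraMap (Polynomial K) (RatFunc K) (∏ j, (c j).denom) * c i =
      algebraMap (Polynomial K) (RatFunc K) p := by
  classical
  refine ⟨(∏ j ∈ Finset.univ.erase i, (c j).denom) * (c i).num, ?_⟩
  rw [← Finset.prod_erase_mul _ _ (Finset.mem_univ i), map_mul, map_mul, mul_assoc]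
  congr 1
  have h : algebraMap (Polynomial K) (RatFunc K) (c i).denom ≠ 0 :=
    RatFunc.algebraMap_ne_zero (c i).denom_ne_zero
  rw [mul_comm, ← eq_div_iff h, RatFunc.num_div_denom]

theorem RatFunc.prod_denom_ne_zero {K : Type*} [Field K] {n : ℕ} (c : Fin n → RatFunc K) :
    ∏ j, (c j).denom ≠ 0 :=
  Finset.prod_ne_zero_iff.2 fun j _ => (c j).denom_ne_zero

theorem hasPoleAt_of_isRoot_prod_denom {K : Type*} [Field K] {n : ℕ} {c : Fin n → RatFunc K}
    {α : K} (h : (∏ j, (c j).denom).IsRoot α) : ∃ j, HasPoleAt (c j) α := by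
  rw [Polynomial.IsRoot, Polynomial.eval_prod, Finset.prod_eq_zero_iff] at h
  obtain ⟨j, -, hj⟩ := h
  exact ⟨j, hj⟩

theorem SatisfiesMahlerEquation.prod_denom_smul_mem {K : Type*} [Field K] {k : ℕ} (hk : k ≠ 0)
    {f : PowerSeries K} {n : ℕ} {c : Fin n → RatFunc K} (h : SatisfiesMahlerEquation k f c) :
    (∏ j, (c j).denom) • f ∈ PowerSeries.iterateSpan hk f 1 := by
  choose p hp using RatFunc.exists_prod_denom_mul_eq c
  refine (PowerSeries.mem_iterateSpan_one_iff hk).2 ⟨n, p, ?_⟩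
  apply HahnSeries.ofPowerSeries_injective (Γ := ℤ)
  rw [map_sum]
  simp only [LaurentSeries.coe_polynomial_smul, ← LaurentSeries.expand_coe]
  conv_lhs => rw [(satisfiesMahlerEquation_iff hk).1 h]
  rw [Finset.smul_sum]
  refine Finset.sum_congr rfl fun i _ => ?_
  rw [← RatFunc.coe_polynomial_mul, ← RatFunc.coe_polynomial_mul, ← hp, ← mul_assoc, ← map_mul]

theorem satisfiesMahlerEquation_div {K : Type*} [Field K] {k : ℕ} (hk : k ≠ 0)
    {f : PowerSeries K} {g : Polynomial K} (hg : g ≠ 0) {m : ℕ} {p : Fin m → Polynomial K}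
    (h : g • f = ∑ i : Fin m, p i •
      PowerSeries.expand (k ^ ((i : ℕ) + 1)) (pow_ne_zero _ hk) f) :
    SatisfiesMahlerEquation k f fun i =>
      algebraMap (Polynomial K) (RatFunc K) (p i) / algebraMap (Polynomial K) (RatFunc K) g := by
  have hg' : algebraMap (Polynomial K) (RatFunc K) g ≠ 0 := RatFunc.algebraMap_ne_zero hg
  have hg'' : ((algebraMap (Polynomial K) (RatFunc K) g : RatFunc K) : K⸨X⸩) ≠ 0 := by
    simpa using hg'
  rw [satisfiesMahlerEquation_iff hk]
  apply mul_left_cancel₀ hg''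
  have h := congrArg (HahnSeries.ofPowerSeries ℤ K) h
  rw [map_sum] at h
  simp only [LaurentSeries.coe_polynomial_smul, ← LaurentSeries.expand_coe] at h
  rw [RatFunc.coe_polynomial_mul, h, Finset.mul_sum]
  refine Finset.sum_congr rfl fun i _ => ?_
  rw [← RatFunc.coe_polynomial_mul, ← mul_assoc, ← map_mul, mul_div_cancel₀ _ hg']

open scoped RatFunc in
theorem SatisfiesMahlerEquation.isRegularPowerSeries {K : Type*} [Field K] [IsAlgClosed K] {k : ℕ}
    (hk : 2 ≤ k) {f : PowerSeries K} {m : ℕ} {d : Fin m → RatFunc K}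
    (hd : SatisfiesMahlerEquation k f d) (hcalm : IsCalmSeq k d) : IsRegularPowerSeries k f := by
  have hk0 : k ≠ 0 := by omega
  obtain ⟨Q, hQ, hdvd⟩ := exists_mul_dvd_expand_of_isCalmNumber hk (RatFunc.prod_denom_ne_zero d)
    fun α hα => (hasPoleAt_of_isRoot_prod_denom hα).elim fun j hj => hcalm j α hj
  choose p hp using RatFunc.exists_prod_denom_mul_eq d
  choose R hR using fun i => Polynomial.mul_dvd_expand_pow hdvd i
  set D := ∏ j, (d j).denom
  set ι := algebraMap (RatFunc K) K⸨X⸩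
  set κ := algebraMap (Polynomial K) (RatFunc K)
  have hQ' : ι (κ Q) ≠ 0 := by
    rw [map_ne_zero]
    exact RatFunc.algebraMap_ne_zero hQ
  set g : K⸨X⸩ := (ι (κ Q))⁻¹ * (f : K⸨X⸩) with hgdef
  have hf : (f : K⸨X⸩) = Q • g := by
    rw [← RatFunc.coe_polynomial_mul, hgdef, mul_inv_cancel_left₀ hQ']
  refine LaurentSeries.isRegularPowerSeries_of_polynomial_equation hk (g := g) (m := m)
    (p := fun i => p i * R i) ?_ hf
  have hfE := (satisfiesMahlerEquation_iff hk0).1 hd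
  -- `d_i(z) Q(z^{k^i}) / Q(z)` is a polynomial, since `D Q` divides `Q(z^{k^i})`.
  conv_lhs => rw [hgdef, hfE, Finset.mul_sum]
  refine Finset.sum_congr rfl fun i _ => ?_
  rw [inv_mul_eq_iff_eq_mul₀ hQ', hf]
  have e : ∀ (q : ℕ) (hq : q ≠ 0), LaurentSeries.expand q hq (Q • g) =
      ι (κ (Polynomial.expand K q Q)) * LaurentSeries.expand q hq g := by
    intro q hq
    rw [LaurentSeries.polynomial_smul_def, map_mul, LaurentSeries.expand_coe,
      ← PowerSeries.coe_polynomial_expand, ← LaurentSeries.polynomial_smul_def,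
      RatFunc.coe_polynomial_mul]
  rw [e, hR, ← RatFunc.coe_polynomial_mul, ← mul_assoc, ← mul_assoc, ← map_mul, ← map_mul]
  congr 2
  simp only [map_mul]
  change d i * (κ D * κ Q * κ (R i)) = κ Q * (κ (p i) * κ (R i))
  rw [← hp]
  ring

theorem mainTheorem1 {K : Type*} [Field K] [IsAlgClosed K] (k : ℕ) (hk : 2 ≤ k)
    (hchar : ringChar K ≠ 0 → k.Coprime (ringChar K))
    (f : PowerSeries K) (n : ℕ) (c : Fin n → RatFunc K)
    (hmin : IsMinimalMahlerEquation k f c)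
    (hpole : ∀ (i : Fin n) (ζ : K), IsRootOfUnity ζ → ¬ HasPoleAt (c i) ζ) :
    IsRegularPowerSeries k f ↔
      ∃ (m : ℕ) (d : Fin m → RatFunc K), SatisfiesMahlerEquation k f d ∧ IsCalmSeq k d := by
  have hk0 : k ≠ 0 := by omega
  constructor
  · intro hreg
    obtain ⟨g, hg, hg0, hgf⟩ := PowerSeries.exists_smul_mem_iterateSpan_of_isRegular hk hreg
      (hmin.1.prod_denom_smul_mem hk0) fun ζ hζ h =>
        (hasPoleAt_of_isRoot_prod_denom h).elim fun j hj => hpole j ζ hζ hj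
    obtain ⟨m, p, hp⟩ := (PowerSeries.mem_iterateSpan_one_iff hk0).1 hgf
    refine ⟨m, _, satisfiesMahlerEquation_div hk0 hg hp, fun i α hα => Or.inl (hg0 α ?_)⟩
    exact Polynomial.IsRoot.dvd hα (RatFunc.denom_div_dvd _ _)
  · rintro ⟨m, d, hd, hcalm⟩
    exact hd.isRegularPowerSeries hk hcalm
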